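/- Let $(M,\mathbf J)$ be a smooth almost complex manifold of real dimension $2n$. A function $h$ on an open subset of $M$ with values in $\mathbb C$ is almost holomorphic if it is smooth and $\mathbf J^{*}dh=i\,dh$, where $(\mathbf J^{*}\omega)(X)=\omega(\mathbf JX)$; a smooth map $f$ from $M$ to a complex manifold is almost holomorphic if $\mathbf J^{*}df=i\,df$. A local Spencer coordinate system of type $m$ ($m\le n$) consists of an open set $U\subset M$ and complex coordinates $(w^1,\dots,w^m,z^{m+1},\dots,z^n)$ on $U$ (a diffeomorphism of $U$ onto an open subset of $\mathbb C^n$) such that the $w^j=f_j$, $j=1,\dots,m$, are almost holomorphic, functionally independent (their differentials are $\mathbb C$-linearly independent at every point of $U$), and form a maximal such system: on no nonempty open subset of $U$ is there an almost holomorphic function $h$ such that $f_1,\dots,f_m,h$ are functionally independent there. Put $f_U=(f_1,\dots,f_m):U\to\mathbb C^m$. Suppose that $M$ is covered by a family $\mathcal A$ of local Spencer coordinate systems of type $m$ (that is, $M$ is of Spencer type $m$). A transition mapping from $U$ to $U'$ ($U,U'\in\mathcal A$) is a biholomorphic mapping $H$ of an open set $f_U(V)$ onto an open set $f_{U'}(V)$,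 where $V\subset U\cap U'$ is open, with $f_{U'}=H\circ f_U$ on $V$. Let $\Gamma$ be the pseudogroup generated by these mappings, and let $\mathbb C^m/\Gamma$ be the quotient of $\mathbb C^m$, with the quotient topology, by the equivalence relation generated by $z\sim H(z)$. Then: (a) There is exactly one map $f:M\to\mathbb C^m/\Gamma$ such that, for all $U\in\mathcal A$ and $p\in U$, $f(p)$ is the equivalence class of $f_U(p)$ (the glued mapping), and it is continuous. (b) A function $h:V\to\mathbb C$ on an open set $V\subset M$ is almost holomorphic if and only if, for all $p\in V$ and all $U\in\mathcal A$ with $p\in U$, there is a holomorphic function $H$ on a neighbourhood of $f_U(p)$ in $\mathbb C^m$ with $h=H\circ f_U$ near $p$. (c) Assume that $\mathbb C^m/\Gamma$ is equipped with the standard complex structure $\mathbf i$ defined by the holomorphic coordinates $(w^1,\dots,w^m)$, i.e. with a structure of complex manifold for which the projection to $\mathbb C^m/\Gamma$ is locally biholomorphic on each open set $f_U(U)\subset\mathbb C^m$, $U\in\mathcal A$. Then the glued mapping $f$ is an almost holomorphic mapping between $(M,\mathbf J)$ and $(\mathbb C^m/\Gamma,\mathbf i)$ (Lemma 4), and the sheaf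 $\mathcal O_M$ of almost holomorphic functions on $M$ is the inverse image under $f$ of the sheaf $\mathcal O_{\mathbb C^m/\Gamma}$ of holomorphic functions on $\mathbb C^m/\Gamma$: composition with $f$ induces an isomorphism $f^{-1}\mathcal O_{\mathbb C^m/\Gamma}\to\mathcal O_M$ of sheaves of rings (Lemma 5). -/

import Mathlib

open scoped Manifold ContDiff Topology
open CategoryTheory TopologicalSpace Opposite

universe u

noncomputable section

namespace Spencer

/-! ### Almost complex manifolds and almost holomorphic functions -/

/-- An almost complex structure on a smooth manifold `M` of real dimension `2n`: a smooth field
`J` of endomorphisms of the tangent spaces with `J² = -1`. -/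
structure AlmostComplexStructure (n : ℕ) (M : Type u) [TopologicalSpace M]
    [ChartedSpace (EuclideanSpace ℝ (Fin (2 * n))) M] [IsManifold (𝓡 (2 * n)) ∞ M] where
  /-- the endomorphism of the tangent space at `p` -/
  toFun : ∀ p : M, TangentSpace (𝓡 (2 * n)) p →L[ℝ] TangentSpace (𝓡 (2 * n)) p
  smooth : ContMDiff (𝓡 (2 * n))
    ((𝓡 (2 * n)).prod
      𝓘(ℝ, EuclideanSpace ℝ (Fin (2 * n)) →L[ℝ] EuclideanSpace ℝ (Fin (2 * n)))) ∞
    (fun p ↦ Bundle.TotalSpace.mk'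
      (EuclideanSpace ℝ (Fin (2 * n)) →L[ℝ] EuclideanSpace ℝ (Fin (2 * n)))
      (E := fun p : M ↦ TangentSpace (𝓡 (2 * n)) p →L[ℝ] TangentSpace (𝓡 (2 * n)) p)
      p (toFun p))
  sq_eq_neg : ∀ p v, toFun p (toFun p v) = -v

section Functions

variable {n : ℕ} {M : Type u} [TopologicalSpace M]
  [ChartedSpace (EuclideanSpace ℝ (Fin (2 * n))) M]

/-- The differential `dh` at `p` of a complex-valued function `h`, as a complex-valued real-linear
form on the tangent space. -/
def differential (h : M → ℂ) (p : M) : TangentSpace (𝓡 (2 * n)) p →L[ℝ] ℂ :=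
  mfderiv (𝓡 (2 * n)) 𝓘(ℝ, ℂ) h p

/-- `f_1, …, f_k` are functionally independent on `U`: their differentials are `ℂ`-linearly
independent at every point of `U`. -/
def FunctionallyIndependentOn {k : ℕ} (f : Fin k → M → ℂ) (U : Set M) : Prop :=
  ∀ p ∈ U, LinearIndependent ℂ (fun j : Fin k ↦ differential (n := n) (f j) p)

variable [IsManifold (𝓡 (2 * n)) ∞ M] (J : AlmostComplexStructure n M)

/-- `h` is smooth near `p` and satisfies `J^* dh = i dh` at `p`. -/
def AlmostHolomorphicAt (h : M → ℂ) (p : M) : Prop :=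
  ContMDiffAt (𝓡 (2 * n)) 𝓘(ℝ, ℂ) ∞ h p ∧
    ∀ v : TangentSpace (𝓡 (2 * n)) p,
      differential h p (J.toFun p v) = Complex.I * differential h p v

/-- `h` is almost holomorphic on (the open set) `U`: it is smooth and `J^* dh = i dh` on `U`. -/
def AlmostHolomorphicOn (h : M → ℂ) (U : Set M) : Prop :=
  ∀ p ∈ U, AlmostHolomorphicAt J h p

/-- The differential at `p` of a map from `M` into an `m`-dimensional complex manifold `N`. -/
def mapDifferential {m : ℕ} {N : Type*} [TopologicalSpace N] [ChartedSpace (Fin m → ℂ) N]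
    (f : M → N) (p : M) : TangentSpace (𝓡 (2 * n)) p →L[ℝ] (Fin m → ℂ) :=
  mfderiv (𝓡 (2 * n)) 𝓘(ℝ, Fin m → ℂ) f p

/-- `f : (M, J) → (N, i)`, with `N` a complex manifold, is almost holomorphic: it is smooth
and `J^* df = i df`. -/
def AlmostHolomorphicMap (m : ℕ) {N : Type*} [TopologicalSpace N] [ChartedSpace (Fin m → ℂ) N]
    (f : M → N) : Prop :=
  ContMDiff (𝓡 (2 * n)) 𝓘(ℝ, Fin m → ℂ) ∞ f ∧
    ∀ (p : M) (v : TangentSpace (𝓡 (2 * n)) p),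
      mapDifferential (m := m) f p (J.toFun p v) = Complex.I • mapDifferential (m := m) f p v

end Functions

/-! ### Spencer coordinates -/

/-- A local Spencer coordinate system of type `m` on `(M, J)`: complex coordinates
`(w^1, …, w^m, z^{m+1}, …, z^n)`, that is, a diffeomorphism of an open set `U = coord.source` of `M`
onto an open subset of `ℂⁿ`, whose first `m` components are functionally independent almost
holomorphic functions on `U` which form a maximal such system: on no nonempty open part of `U` can
they be completed by one more almost holomorphic function to a functionally independent system. -/
structure SpencerSystem {n : ℕ} {M : Type u} [TopologicalSpace M]
    [ChartedSpace (EuclideanSpace ℝ (Fin (2 * n))) M] [IsManifold (𝓡 (2 * n)) ∞ M]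
    (J : AlmostComplexStructure n M) (m : ℕ) where
  le : m ≤ n
  coord : OpenPartialHomeomorph M (Fin n → ℂ)
  smooth : ContMDiffOn (𝓡 (2 * n)) 𝓘(ℝ, Fin n → ℂ) ∞ coord coord.source
  smooth_symm : ContMDiffOn 𝓘(ℝ, Fin n → ℂ) (𝓡 (2 * n)) ∞ coord.symm coord.target
  almostHolomorphic : ∀ j : Fin m,
    AlmostHolomorphicOn J (fun p ↦ coord p (Fin.castLE le j)) coord.source
  independent : FunctionallyIndependentOn (n := n)
    (fun (j : Fin m) (p : M) ↦ coord p (Fin.castLE le j)) coord.source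
  maximal : ∀ V : Set M, IsOpen V → V.Nonempty → V ⊆ coord.source →
    ∀ h : M → ℂ, AlmostHolomorphicOn J h V →
      ¬ FunctionallyIndependentOn (n := n) (Fin.snoc (α := fun _ ↦ M → ℂ)
          (fun (j : Fin m) (p : M) ↦ coord p (Fin.castLE le j)) h) V

namespace SpencerSystem

variable {n : ℕ} {M : Type u} [TopologicalSpace M]
  [ChartedSpace (EuclideanSpace ℝ (Fin (2 * n))) M] [IsManifold (𝓡 (2 * n)) ∞ M]
  {J : AlmostComplexStructure n M} {m : ℕ}

/-- The domain `U` of the coordinate system. -/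
def dom (S : SpencerSystem J m) : Set M := S.coord.source

/-- The mapping `f_U = (f_1, …, f_m) : U → ℂ^m`. -/
def toMap (S : SpencerSystem J m) (p : M) : Fin m → ℂ := fun j ↦ S.coord p (Fin.castLE S.le j)

/-- The open set `f_U(U)` of `ℂ^m`. -/
def image (S : SpencerSystem J m) : Set (Fin m → ℂ) := S.toMap '' S.dom

end SpencerSystem

/-- `H` is a holomorphic transition mapping from the holomorphic coordinates of `S` to those of `T`:
for some open `V ⊆ U_S ∩ U_T` it is a biholomorphic mapping of the open set `f_S(V)` onto the open
set `f_T(V)` with `f_T = H ∘ f_S` on `V`. -/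
def IsTransition {n : ℕ} {M : Type u} [TopologicalSpace M]
    [ChartedSpace (EuclideanSpace ℝ (Fin (2 * n))) M] [IsManifold (𝓡 (2 * n)) ∞ M]
    {J : AlmostComplexStructure n M} {m : ℕ} (S T : SpencerSystem J m)
    (H : OpenPartialHomeomorph (Fin m → ℂ) (Fin m → ℂ)) : Prop :=
  ∃ V : Set M, IsOpen V ∧ V ⊆ S.dom ∩ T.dom ∧
    H.source = S.toMap '' V ∧ H.target = T.toMap '' V ∧
    ContDiffOn ℂ ∞ H H.source ∧ ContDiffOn ℂ ∞ H.symm H.target ∧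
    ∀ p ∈ V, T.toMap p = H (S.toMap p)

/-- An atlas of local Spencer coordinate systems of type `m`: together with it, `(M, J)` is an
almost complex manifold of Spencer type `m`. -/
structure SpencerAtlas {n : ℕ} {M : Type u} [TopologicalSpace M]
    [ChartedSpace (EuclideanSpace ℝ (Fin (2 * n))) M] [IsManifold (𝓡 (2 * n)) ∞ M]
    (J : AlmostComplexStructure n M) (m : ℕ) (ι : Type*) where
  chart : ι → SpencerSystem J m
  covers : ∀ p : M, ∃ i, p ∈ (chart i).dom

namespace SpencerAtlas

variable {n : ℕ} {M : Type u} [TopologicalSpace M]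
  [ChartedSpace (EuclideanSpace ℝ (Fin (2 * n))) M] [IsManifold (𝓡 (2 * n)) ∞ M]
  {J : AlmostComplexStructure n M} {m : ℕ} {ι : Type*}

/-- The equivalence of points of `ℂ^m` under the pseudogroup `Γ` of the atlas: the equivalence
relation generated by `z ∼ H(z)`, for the holomorphic transition mappings `H` between the
coordinate systems of the atlas. -/
def pointSetoid (A : SpencerAtlas J m ι) : Setoid (Fin m → ℂ) :=
  Relation.EqvGen.setoid fun z w ↦
    ∃ (i j : ι) (H : OpenPartialHomeomorph (Fin m → ℂ) (Fin m → ℂ)),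
      IsTransition (A.chart i) (A.chart j) H ∧ z ∈ H.source ∧ H z = w

/-- The space `ℂ^m/Γ` of equivalence classes of points of `ℂ^m`, with the quotient topology
(the `ULift` only places it in the same universe as `M`). -/
def QuotientSpace (A : SpencerAtlas J m ι) : Type u := ULift.{u} (Quotient A.pointSetoid)

instance (A : SpencerAtlas J m ι) : TopologicalSpace A.QuotientSpace :=
  inferInstanceAs (TopologicalSpace (ULift.{u} (Quotient A.pointSetoid)))

/-- The equivalence class of a point of `ℂ^m`. -/
def proj (A : SpencerAtlas J m ι) (z : Fin m → ℂ) : A.QuotientSpace :=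
  ULift.up (Quotient.mk A.pointSetoid z)

/-- `f : M → ℂ^m/Γ` is the glued mapping: `f(p)` is the equivalence class of `f_U(p)`, for every
coordinate system of the atlas with `p ∈ U`. -/
def IsGlued (A : SpencerAtlas J m ι) (f : M → A.QuotientSpace) : Prop :=
  ∀ i, ∀ p ∈ (A.chart i).dom, f p = A.proj ((A.chart i).toMap p)

/-- A complex manifold structure on `ℂ^m/Γ` is the standard one, defined by the holomorphic
coordinates `(w^1, …, w^m)`, if those are local holomorphic coordinates for it: on each of the open
sets `f_U(U)` the projection onto `ℂ^m/Γ` is locally biholomorphic. -/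
def IsStandardStructure (A : SpencerAtlas J m ι) [ChartedSpace (Fin m → ℂ) A.QuotientSpace] :
    Prop :=
  ∀ i, IsLocalDiffeomorphOn 𝓘(ℂ, Fin m → ℂ) 𝓘(ℂ, Fin m → ℂ) ∞ A.proj (A.chart i).image

end SpencerAtlas

/-! ### Sheaves of functions -/

/-- A condition on complex-valued functions at points of `X`, preserved by the ring operations:
`cond x` is the ring of the functions that satisfy it at `x`. -/
structure FunctionCondition (X : Type u) where
  cond : X → Subring (X → ℂ)

namespace FunctionCondition

variable {X : Type u} [TopologicalSpace X]

/-- The ring of the functions `s : U → ℂ` that satisfy the condition at each point of the open set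
`U`, in the sense that near the point `s` agrees with a function on `X` that does. -/
def sections (R : FunctionCondition X) (U : Opens (TopCat.of X)) : Subring (U → ℂ) where
  carrier := {s | ∀ x : U, ∃ h ∈ R.cond x.1, ∀ᶠ y in 𝓝 x, s y = h y.1}
  mul_mem' := by
    intro s t hs ht x
    obtain ⟨h, hh, hs⟩ := hs x
    obtain ⟨k, hk, ht⟩ := ht x
    refine ⟨h * k, mul_mem hh hk, ?_⟩
    filter_upwards [hs, ht] with y h1 h2
    simp [h1, h2]
  one_mem' := fun x ↦ ⟨1, one_mem _, Filter.Eventually.of_forall fun _ ↦ rfl⟩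
  add_mem' := by
    intro s t hs ht x
    obtain ⟨h, hh, hs⟩ := hs x
    obtain ⟨k, hk, ht⟩ := ht x
    refine ⟨h + k, add_mem hh hk, ?_⟩
    filter_upwards [hs, ht] with y h1 h2
    simp [h1, h2]
  zero_mem' := fun x ↦ ⟨0, zero_mem _, Filter.Eventually.of_forall fun _ ↦ rfl⟩
  neg_mem' := by
    intro s hs x
    obtain ⟨h, hh, hs⟩ := hs x
    refine ⟨-h, neg_mem hh, ?_⟩
    filter_upwards [hs] with y h1
    simp [h1]

/-- The inclusion of open sets, as a continuous map. -/
theorem continuous_incl {U V : Opens (TopCat.of X)} (i : V ≤ U) :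
    Continuous (fun x : V ↦ (⟨x.1, i x.2⟩ : U)) :=
  Continuous.subtype_mk continuous_subtype_val _

/-- Restriction of sections. -/
def restrict (R : FunctionCondition X) {U V : Opens (TopCat.of X)} (i : V ≤ U) :
    R.sections U →+* R.sections V where
  toFun s := ⟨fun x ↦ s.1 ⟨x.1, i x.2⟩, fun x ↦ by
    obtain ⟨h, hh, hs⟩ := s.2 ⟨x.1, i x.2⟩
    exact ⟨h, hh, (continuous_incl i).continuousAt.eventually hs⟩⟩
  map_one' := rfl
  map_mul' _ _ := rfl
  map_zero' := rfl
  map_add' _ _ := rfl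

/-- The presheaf of rings of the functions that satisfy the condition. -/
def presheaf (R : FunctionCondition X) : TopCat.Presheaf CommRingCat.{u} (TopCat.of X) where
  obj U := CommRingCat.of (R.sections U.unop)
  map i := CommRingCat.ofHom (R.restrict i.unop.le)
  map_id _ := rfl
  map_comp _ _ := rfl

/-- The same sections, as a local predicate on functions. -/
def localPredicate (R : FunctionCondition X) :
    TopCat.LocalPredicate (fun _ : TopCat.of X ↦ ℂ) where
  pred {U} s := s ∈ R.sections U
  res i s hs := (R.restrict i.le ⟨s, hs⟩).2
  locality {U} s w x := by
    obtain ⟨V, hx, i, h⟩ := w x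
    obtain ⟨k, hk, e⟩ := h ⟨x.1, hx⟩
    refine ⟨k, hk, ?_⟩
    have e' : ∀ᶠ y in 𝓝 x.1, ∀ hy : y ∈ V, s ⟨y, i.le hy⟩ = k y := by
      rw [nhds_subtype_eq_comap, Filter.eventually_comap] at e
      filter_upwards [e] with y h1 hy
      exact h1 ⟨y, hy⟩ rfl
    have hV : ∀ᶠ y in 𝓝 x.1, y ∈ V := V.isOpen.mem_nhds hx
    have := continuous_subtype_val.continuousAt.eventually (e'.and hV)
    filter_upwards [this] with y h1
    exact h1.1 h1.2

theorem isSheaf (R : FunctionCondition X) : TopCat.Presheaf.IsSheaf R.presheaf := by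
  unfold TopCat.Presheaf.IsSheaf
  rw [CategoryTheory.Presheaf.isSheaf_iff_isSheaf_forget _ _ (CategoryTheory.forget CommRingCat)]
  exact TopCat.subpresheafToTypes.isSheaf R.localPredicate

/-- The sheaf of rings of the functions that satisfy the condition. -/
def sheaf (R : FunctionCondition X) : TopCat.Sheaf CommRingCat.{u} (TopCat.of X) :=
  ⟨R.presheaf, R.isSheaf⟩

end FunctionCondition

/-- The sheaf `F` of functions on `X` is the inverse image under `f : X → Y` of the sheaf `G` of
functions on `Y`, by composition with `f`: composition `g ↦ g ∘ f` is a morphism of sheaves of rings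
`G ⟶ f_* F`, and the corresponding morphism `f⁻¹ G ⟶ F` is an isomorphism. -/
def IsInverseImage {X Y : Type u} [TopologicalSpace X] [TopologicalSpace Y] (f : C(X, Y))
    (F : FunctionCondition X) (G : FunctionCondition Y) : Prop :=
  ∃ φ : G.sheaf ⟶ (TopCat.Sheaf.pushforward CommRingCat.{u} (TopCat.ofHom f)).obj F.sheaf,
    (∀ (W : Opens (TopCat.of Y)) (g : G.sections W)
        (x : (Opens.map (TopCat.ofHom f)).obj W),
      ((φ.hom.app (op W)).hom g : F.sections ((Opens.map (TopCat.ofHom f)).obj W)).1 x =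
        g.1 ⟨f x.1, x.2⟩) ∧
    IsIso (((TopCat.Sheaf.pullbackPushforwardAdjunction CommRingCat.{u}
      (TopCat.ofHom f)).homEquiv G.sheaf F.sheaf).symm φ)

/-- The condition of being holomorphic near a point of a complex manifold `N`; its sheaf is the
sheaf `𝒪_N` of holomorphic functions. -/
def holomorphic (m : ℕ) (N : Type u) [TopologicalSpace N] [ChartedSpace (Fin m → ℂ) N] :
    FunctionCondition N where
  cond x :=
    { carrier := {h | ContMDiffAt 𝓘(ℂ, Fin m → ℂ) 𝓘(ℂ, ℂ) ∞ h x}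
      mul_mem' := fun ha hb ↦ ContMDiffAt.mul ha hb
      one_mem' := contMDiffAt_const
      add_mem' := fun ha hb ↦ ContMDiffAt.add ha hb
      zero_mem' := contMDiffAt_const
      neg_mem' := fun ha ↦ ContMDiffAt.neg ha }

section AlmostHolomorphicSheaf

variable {n : ℕ} {M : Type u} [TopologicalSpace M]
  [ChartedSpace (EuclideanSpace ℝ (Fin (2 * n))) M] [IsManifold (𝓡 (2 * n)) ∞ M]

theorem AlmostHolomorphicAt.const (J : AlmostComplexStructure n M) (c : ℂ) (p : M) :
    AlmostHolomorphicAt J (fun _ ↦ c) p := by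
  refine ⟨contMDiffAt_const, fun v ↦ ?_⟩
  have h : differential (n := n) (fun _ : M ↦ c) p = 0 := mfderiv_const
  simp [h]

theorem AlmostHolomorphicAt.add {J : AlmostComplexStructure n M} {a b : M → ℂ} {p : M}
    (ha : AlmostHolomorphicAt J a p) (hb : AlmostHolomorphicAt J b p) :
    AlmostHolomorphicAt J (a + b) p := by
  refine ⟨ContMDiffAt.add ha.1 hb.1, fun v ↦ ?_⟩
  have h : differential (n := n) (a + b) p = differential a p + differential b p :=
    ((ha.1.mdifferentiableAt (by simp)).hasMFDerivAt.add
      (hb.1.mdifferentiableAt (by simp)).hasMFDerivAt).mfderiv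
  have h1 := ha.2 v
  have h2 := hb.2 v
  simp only [h, _root_.add_apply, h1, h2]
  ring

theorem AlmostHolomorphicAt.mul {J : AlmostComplexStructure n M} {a b : M → ℂ} {p : M}
    (ha : AlmostHolomorphicAt J a p) (hb : AlmostHolomorphicAt J b p) :
    AlmostHolomorphicAt J (a * b) p := by
  refine ⟨(contDiff_mul (𝕜 := ℝ) (𝔸 := ℂ)).contMDiff.contMDiffAt.comp p
    (ha.1.prodMk_space hb.1), fun v ↦ ?_⟩
  have h : differential (n := n) (a * b) p = a p • differential b p + b p • differential a p :=
    ((ha.1.mdifferentiableAt (by simp)).hasMFDerivAt.mul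
      (hb.1.mdifferentiableAt (by simp)).hasMFDerivAt).mfderiv
  have h1 := ha.2 v
  have h2 := hb.2 v
  simp only [h, _root_.add_apply, _root_.smul_apply, h1, h2, smul_eq_mul]
  ring

/-- The condition of being almost holomorphic near a point; its sheaf is the sheaf of almost
holomorphic functions on `(M, J)`. -/
def almostHolomorphic (J : AlmostComplexStructure n M) : FunctionCondition M where
  cond p :=
    { carrier := {h | AlmostHolomorphicAt J h p}
      mul_mem' := fun ha hb ↦ ha.mul hb
      one_mem' := AlmostHolomorphicAt.const J 1 p
      add_mem' := fun ha hb ↦ ha.add hb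
      zero_mem' := AlmostHolomorphicAt.const J 0 p
      neg_mem' := fun {a} ha ↦ by
        have h := (AlmostHolomorphicAt.const J (-1) p).mul ha
        have e : (fun _ : M ↦ (-1 : ℂ)) * a = -a := by
          funext x
          simp
        rw [e] at h
        exact h }

end AlmostHolomorphicSheaf

end Spencer

end

/-! Everything rests on one consequence of maximality: the differential of an almost holomorphic
function $h$ is pointwise a $\mathbb C$-combination of $dw^1,\dots,dw^m$. If this failed at a point
it would fail on an open set, and there $h$ would complete the $w^j$ to a larger independent system
(`fderiv_comp_symm_eq_sum`). In the coordinates $(w,z)$ the derivative of $h$ therefore vanishes in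
the $z$-directions and is $\mathbb C$-linear in the $w$-directions, so locally $h$ is a holomorphic
function of $w$ (`SpencerSystem.exists_holomorphic_eventuallyEq`). The converse is the chain rule,
which gives (b).

Applied to the coordinates of a second system, this shows that $f_U$ and $f_{U'}$ are locally
holomorphic functions of each other, hence related by a transition mapping (`exists_isTransition`).
So the class of $f_U(p)$ does not depend on $U$, which gives (a).

For (c), $f$ is locally $f_U$, an open almost holomorphic map, followed by a local biholomorphism;
so $f$ is open and almost holomorphic. Each germ of $\mathcal O_M$ at $p$ comes from a germ at
$f(p)$ by (b), and from only one because $f$ is open. The map from the inverse image presheaf to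
$\mathcal O_M$ is thus bijective on stalks, hence becomes an isomorphism after sheafification
(`isInverseImage_of_isOpenMap`). -/

namespace Spencer

/-! ### Real smoothness and complex differentiability -/

section Complex

/-- A real-linear map that commutes with multiplication by `i` is complex-linear. -/
noncomputable def complexLinear {E F : Type*} [NormedAddCommGroup E] [NormedSpace ℂ E] [NormedAddCommGroup F]
    [NormedSpace ℂ F] (L : E →L[ℝ] F) (hL : ∀ v, L (Complex.I • v) = Complex.I • L v) :
    E →L[ℂ] F where
  toFun := L
  map_add' := L.map_add
  map_smul' c v := by
    have h : c • v = c.re • v + c.im • (Complex.I • v) := by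
      conv_lhs => rw [← Complex.re_add_im c]
      rw [add_smul, mul_smul, Complex.coe_smul, Complex.coe_smul]
    have h' : c • L v = c.re • L v + c.im • (Complex.I • L v) := by
      conv_lhs => rw [← Complex.re_add_im c]
      rw [add_smul, mul_smul, Complex.coe_smul, Complex.coe_smul]
    rw [h, map_add, map_smul, map_smul, hL, RingHom.id_apply, h']
  cont := L.cont

variable {E F : Type*} [NormedAddCommGroup E] [NormedSpace ℂ E] [NormedAddCommGroup F]
    [NormedSpace ℂ F]

/-- The Cauchy–Riemann criterion: a real derivative that commutes with $i$ is a complex derivative.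
-/
theorem differentiableAt_complex_of_fderiv_I {f : E → F} {x : E} (hf : DifferentiableAt ℝ f x)
    (hI : ∀ v, fderiv ℝ f x (Complex.I • v) = Complex.I • fderiv ℝ f x v) :
    DifferentiableAt ℂ f x :=
  (differentiableAt_iff_restrictScalars ℝ hf).2 ⟨complexLinear _ hI, by ext; rfl⟩

theorem fderiv_I_of_differentiableAt {f : E → F} {x : E} (hf : DifferentiableAt ℂ f x) (v : E) :
    fderiv ℝ f x (Complex.I • v) = Complex.I • fderiv ℝ f x v := by
  rw [hf.fderiv_restrictScalars ℝ]
  simp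

/-- The directional derivatives of a smooth holomorphic map are holomorphic. -/
theorem differentiableAt_complex_fderiv_apply {f : E → F} {s : Set E} (hs : IsOpen s)
    (hf : ContDiffOn ℝ ∞ f s) (hd : DifferentiableOn ℂ f s) (v : E) {x : E} (hx : x ∈ s) :
    DifferentiableAt ℂ (fun y ↦ fderiv ℝ f y v) x := by
  have hfx : ContDiffAt ℝ ∞ f x := hf.contDiffAt (hs.mem_nhds hx)
  have hD : DifferentiableAt ℝ (fderiv ℝ f) x :=
    (hfx.fderiv_right (m := 1) (by norm_cast)).differentiableAt (by simp)
  have hA (w : E) : HasFDerivAt (fun y ↦ fderiv ℝ f y w) ((fderiv ℝ (fderiv ℝ f) x).flip w) x := by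
    simpa using hD.hasFDerivAt.clm_apply (hasFDerivAt_const w x)
  have hsymm : IsSymmSndFDerivAt ℝ f x := hfx.isSymmSndFDerivAt (by simpa using WithTop.coe_le_coe.2 (le_top (a := (2 : ℕ∞))))
  refine differentiableAt_complex_of_fderiv_I (hA v).differentiableAt fun w ↦ ?_
  -- Differentiating this identity in the direction `v` gives $D^2f(v, iw) = i\,D^2f(v, w)$;
  -- symmetry of $D^2f$ turns it into the Cauchy–Riemann equation for $y \mapsto Df_y(v)$.
  have e : (fun y ↦ fderiv ℝ f y (Complex.I • w)) =ᶠ[𝓝 x]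
      fun y ↦ Complex.I • fderiv ℝ f y w := by
    filter_upwards [hs.mem_nhds hx] with y hy
    exact fderiv_I_of_differentiableAt (hd.differentiableAt (hs.mem_nhds hy)) w
  have h1 := (hA (Complex.I • w)).unique (((hA w).const_smul Complex.I).congr_of_eventuallyEq e)
  rw [(hA v).fderiv, ContinuousLinearMap.flip_apply, ContinuousLinearMap.flip_apply,
    hsymm.eq, hsymm.eq w v]
  exact DFunLike.congr_fun h1 v

/-- A holomorphic map that is smooth over `ℝ` is smooth over `ℂ`. -/
theorem contDiffOn_complex_of_real [FiniteDimensional ℂ E] {f : E → F} {s : Set E}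
    (hs : IsOpen s) (hf : ContDiffOn ℝ ∞ f s) (hd : DifferentiableOn ℂ f s) :
    ContDiffOn ℂ ∞ f s := by
  rw [contDiffOn_infty]
  intro k
  induction k generalizing f with
  | zero => exact contDiffOn_zero.2 hd.continuousOn
  | succ k ih =>
    have : ((k + 1 : ℕ) : ℕ∞ω) = k + 1 := by norm_cast
    rw [this, contDiffOn_succ_iff_fderiv_of_isOpen hs]
    -- In finite dimension the derivative may be tested on each vector `v`. The directional
    -- derivatives are again smooth over `ℝ` and holomorphic, so the induction hypothesis applies to
    -- them.
    refine ⟨hd, by simp, contDiffOn_clm_apply.2 fun v ↦ ?_⟩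
    have h1 : ContDiffOn ℝ ∞ (fun y ↦ fderiv ℝ f y v) s :=
      (hf.fderiv_of_isOpen hs (by simp)).clm_apply contDiffOn_const
    refine (ih h1 fun x hx ↦ (differentiableAt_complex_fderiv_apply hs hf hd v
      hx).differentiableWithinAt).congr fun y hy ↦ ?_
    rw [(hd.differentiableAt (hs.mem_nhds hy)).fderiv_restrictScalars ℝ]
    rfl

end Complex

end Spencer

/-! ### Almost holomorphic functions in Spencer coordinates -/

namespace Spencer

variable {n : ℕ} {M : Type u} [TopologicalSpace M]
  [ChartedSpace (EuclideanSpace ℝ (Fin (2 * n))) M] [IsManifold (𝓡 (2 * n)) ∞ M]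
  {J : AlmostComplexStructure n M} {m : ℕ}

theorem AlmostHolomorphicAt.congr_of_eventuallyEq {h k : M → ℂ} {p : M}
    (hk : AlmostHolomorphicAt J k p) (e : h =ᶠ[𝓝 p] k) : AlmostHolomorphicAt J h p := by
  refine ⟨hk.1.congr_of_eventuallyEq e, fun v ↦ ?_⟩
  have : differential (n := n) h p = differential k p := e.mfderiv_eq
  rw [this]
  exact hk.2 v

namespace SpencerSystem

variable (S : SpencerSystem J m)

theorem isOpen_dom : IsOpen S.dom := S.coord.open_source

theorem mdifferentiableAt_symm {x : Fin n → ℂ} (hx : x ∈ S.coord.target) :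
    MDifferentiableAt 𝓘(ℝ, Fin n → ℂ) (𝓡 (2 * n)) S.coord.symm x :=
  (S.smooth_symm.contMDiffAt (S.coord.open_target.mem_nhds hx)).mdifferentiableAt (by simp)

/-- The expression in the coordinates of a function that is smooth near `p` is smooth. -/
theorem contDiffAt_comp_symm {h : M → ℂ} {x : Fin n → ℂ} (hx : x ∈ S.coord.target)
    (hh : ContMDiffAt (𝓡 (2 * n)) 𝓘(ℝ, ℂ) ∞ h (S.coord.symm x)) :
    ContDiffAt ℝ ∞ (h ∘ S.coord.symm) x :=
  contMDiffAt_iff_contDiffAt.1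
    (hh.comp x (S.smooth_symm.contMDiffAt (S.coord.open_target.mem_nhds hx)))

theorem fderiv_comp_symm {h : M → ℂ} {x : Fin n → ℂ} (hx : x ∈ S.coord.target)
    (hh : ContMDiffAt (𝓡 (2 * n)) 𝓘(ℝ, ℂ) ∞ h (S.coord.symm x)) (v : Fin n → ℂ) :
    fderiv ℝ (h ∘ S.coord.symm) x v = differential h (S.coord.symm x)
      (mfderiv 𝓘(ℝ, Fin n → ℂ) (𝓡 (2 * n)) S.coord.symm x v) := by
  rw [← mfderiv_eq_fderiv]
  exact DFunLike.congr_fun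
    (mfderiv_comp x (hh.mdifferentiableAt (by simp)) (S.mdifferentiableAt_symm hx)) v

/-- The differential of the coordinate `w^j`, in the coordinates. -/
theorem differential_coord_comp (j : Fin m) {x : Fin n → ℂ} (hx : x ∈ S.coord.target)
    (v : Fin n → ℂ) :
    differential (fun p ↦ S.coord p (Fin.castLE S.le j)) (S.coord.symm x)
      (mfderiv 𝓘(ℝ, Fin n → ℂ) (𝓡 (2 * n)) S.coord.symm x v) = v (Fin.castLE S.le j) := by
  have h := S.fderiv_comp_symm hx
    ((S.almostHolomorphic j) (S.coord.symm x) (S.coord.map_target hx)).1 v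
  have e : ((fun p ↦ S.coord p (Fin.castLE S.le j)) ∘ S.coord.symm) =ᶠ[𝓝 x]
      (ContinuousLinearMap.proj (R := ℝ) (φ := fun _ : Fin n ↦ ℂ) (Fin.castLE S.le j)) := by
    filter_upwards [S.coord.open_target.mem_nhds hx] with y hy
    simp [S.coord.right_inv hy]
  rw [e.fderiv_eq, ContinuousLinearMap.fderiv] at h
  exact h.symm

/-- By maximality, the differential of an almost holomorphic function is a combination of the
differentials of the coordinates `w^j`. -/
theorem fderiv_comp_symm_eq_sum {V : Set M} (hV : IsOpen V) {h : M → ℂ}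
    (hh : AlmostHolomorphicOn J h V) {x : Fin n → ℂ} (hx : x ∈ S.coord.target)
    (hxV : S.coord.symm x ∈ V) (v : Fin n → ℂ) :
    fderiv ℝ (h ∘ S.coord.symm) x v = ∑ j : Fin m, v (Fin.castLE S.le j) *
      fderiv ℝ (h ∘ S.coord.symm) x (Pi.single (Fin.castLE S.le j) 1) := by
  by_contra hne
  set g := h ∘ S.coord.symm with hg
  set O : Set (Fin n → ℂ) := S.coord.target ∩ S.coord.symm ⁻¹' V with hO
  have hOo : IsOpen O := S.coord.isOpen_inter_preimage_symm hV
  have hgO : ContDiffOn ℝ ∞ g O := fun y hy ↦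
    (S.contDiffAt_comp_symm hy.1 (hh _ hy.2).1).contDiffWithinAt
  have hD : ContinuousOn (fderiv ℝ g) O := hgO.continuousOn_fderiv_of_isOpen hOo (by simp)
  -- The identity fails exactly on `B` (for this fixed `v`). Continuity of the derivative makes `B`
  -- open, and it contains `x`, so maximality is contradicted once independence is shown over `B`.
  let B : Set (Fin n → ℂ) := O ∩ {y | fderiv ℝ g y v - ∑ j : Fin m, v (Fin.castLE S.le j) *
      fderiv ℝ g y (Pi.single (Fin.castLE S.le j) 1) ∈ ({0}ᶜ : Set ℂ)}
  have hB : IsOpen B := by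
    refine ContinuousOn.isOpen_inter_preimage (f := fun y ↦ fderiv ℝ g y v -
      ∑ j : Fin m, v (Fin.castLE S.le j) * fderiv ℝ g y (Pi.single (Fin.castLE S.le j) 1))
      ?_ hOo isClosed_singleton.isOpen_compl
    fun_prop
  refine S.maximal (S.coord.source ∩ S.coord ⁻¹' B) (S.coord.isOpen_inter_preimage hB)
    ⟨S.coord.symm x, S.coord.map_target hx, ?_⟩ Set.inter_subset_left h ?_ ?_
  · rw [Set.mem_preimage, S.coord.right_inv hx]
    exact ⟨⟨hx, hxV⟩, fun h0 ↦ hne (sub_eq_zero.1 h0)⟩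
  · intro q hq
    have := hq.2.1.2
    rw [Set.mem_preimage, S.coord.left_inv hq.1] at this
    exact hh q this
  · intro q hq
    obtain ⟨y, hy, rfl⟩ : ∃ y ∈ S.coord.target, S.coord.symm y = q :=
      ⟨S.coord q, S.coord.map_source hq.1, S.coord.left_inv hq.1⟩
    have hyB : y ∈ B := by simpa [S.coord.right_inv hy] using hq.2
    have e : (fun j : Fin (m + 1) ↦ differential (n := n) (Fin.snoc (α := fun _ ↦ M → ℂ)
          (fun (j : Fin m) (p : M) ↦ S.coord p (Fin.castLE S.le j)) h j) (S.coord.symm y)) =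
        Fin.snoc (α := fun _ ↦ TangentSpace (𝓡 (2 * n)) (S.coord.symm y) →L[ℝ] ℂ)
          (fun j : Fin m ↦ differential (n := n) (fun p ↦ S.coord p (Fin.castLE S.le j))
            (S.coord.symm y)) (differential h (S.coord.symm y)) := by
      funext j
      refine Fin.lastCases ?_ (fun j ↦ ?_) j <;> simp
    rw [e]
    refine linearIndependent_finSnoc.2 ⟨S.independent _ hq.1, fun hmem ↦ hyB.2 ?_⟩
    obtain ⟨c, hc⟩ := (Submodule.mem_span_range_iff_exists_fun ℂ).1 hmem
    -- A relation $dh=\sum c_j\,dw^j$ at `y`, evaluated on the basis vectors, identifies $c_j$ with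
    -- the $j$-th coefficient in the identity, which then holds at `y`, against `y ∈ B`.
    have key (w : Fin n → ℂ) : fderiv ℝ g y w = ∑ j : Fin m, c j * w (Fin.castLE S.le j) := by
      rw [hg, S.fderiv_comp_symm hy (hh _ hyB.1.2).1, ← hc, _root_.sum_apply]
      refine Finset.sum_congr rfl fun j _ ↦ ?_
      rw [_root_.smul_apply, S.differential_coord_comp j hy, smul_eq_mul]
    change _ - _ = (0 : ℂ)
    rw [sub_eq_zero, key]
    refine Finset.sum_congr rfl fun j _ ↦ ?_
    rw [key, Finset.sum_eq_single j]
    · simp [mul_comm]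
    · intro i _ hij
      rw [Pi.single_eq_of_ne, mul_zero]
      exact fun h ↦ hij (Fin.castLE_injective S.le h)
    · simp

/-- Near a point, an almost holomorphic function is a holomorphic function of the `w^j`. -/
theorem exists_holomorphic_eventuallyEq {V : Set M} (hV : IsOpen V) {h : M → ℂ}
    (hh : AlmostHolomorphicOn J h V) {p : M} (hpV : p ∈ V) (hp : p ∈ S.dom) :
    ∃ (W : Set (Fin m → ℂ)) (H : (Fin m → ℂ) → ℂ), IsOpen W ∧ S.toMap p ∈ W ∧
      ContDiffOn ℂ ∞ H W ∧ ∀ᶠ q in 𝓝 p, h q = H (S.toMap q) := by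
  set g := h ∘ S.coord.symm with hg
  set O : Set (Fin n → ℂ) := S.coord.target ∩ S.coord.symm ⁻¹' V with hO
  have hOo : IsOpen O := S.coord.isOpen_inter_preimage_symm hV
  have hpO : S.coord p ∈ O :=
    ⟨S.coord.map_source hp, by rwa [Set.mem_preimage, S.coord.left_inv hp]⟩
  obtain ⟨r, hr, hrO⟩ := Metric.isOpen_iff.1 hOo _ hpO
  have hgd {y : Fin n → ℂ} (hy : y ∈ O) : ContDiffAt ℝ ∞ g y :=
    S.contDiffAt_comp_symm hy.1 (hh _ hy.2).1
  -- The map `w ↦ L w + c` parametrizes the slice through `p`: the first `m` coordinates are `w`,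
  -- the others are frozen at their values at `p`. The required function is `g` restricted to this
  -- slice.
  let L : (Fin m → ℂ) →L[ℝ] (Fin n → ℂ) := ContinuousLinearMap.pi fun k ↦
    if hk : k.1 < m then ContinuousLinearMap.proj (R := ℝ) (φ := fun _ : Fin m ↦ ℂ) ⟨k.1, hk⟩ else 0
  let c : Fin n → ℂ := fun k ↦ if k.1 < m then 0 else S.coord p k
  have hL (w : Fin m → ℂ) (j : Fin m) : L w (Fin.castLE S.le j) = w j := by simp [L]
  have hc (j : Fin m) : c (Fin.castLE S.le j) = 0 := by simp [c]
  have hLc {w : Fin m → ℂ} (hw : w ∈ Metric.ball (S.toMap p) r) :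
      L w + c ∈ Metric.ball (S.coord p) r := by
    -- Balls for the sup metric are polydiscs, so the same radius `r` serves in `ℂ^m` and in `ℂⁿ`.
    rw [Metric.mem_ball, dist_pi_lt_iff hr] at hw ⊢
    intro k
    by_cases hk : k.1 < m
    · have h1 : dist (w ⟨k.1, hk⟩) (S.coord p k) < r := hw ⟨k.1, hk⟩
      simpa [L, c, hk] using h1
    · simpa [L, c, hk] using hr
  have hsum (w : Fin m → ℂ) (hw : w ∈ Metric.ball (S.toMap p) r) (v : Fin m → ℂ) :
      fderiv ℝ (fun w ↦ g (L w + c)) w v = ∑ j : Fin m, v j *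
        fderiv ℝ g (L w + c) (Pi.single (Fin.castLE S.le j) 1) := by
    have hy := hrO (hLc hw)
    have h1 : HasFDerivAt (fun w ↦ g (L w + c)) ((fderiv ℝ g (L w + c)).comp L) w :=
      ((hgd hy).differentiableAt (by simp)).hasFDerivAt.comp w (L.hasFDerivAt.add_const c)
    rw [h1.fderiv, ContinuousLinearMap.comp_apply, S.fderiv_comp_symm_eq_sum hV hh hy.1 hy.2]
    simp_rw [hL]
    rfl
  have hH : ContDiffOn ℝ ∞ (fun w ↦ g (L w + c)) (Metric.ball (S.toMap p) r) := fun w hw ↦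
    ((hgd (hrO (hLc hw))).comp w
      (L.contDiff.contDiffAt.add contDiffAt_const)).contDiffWithinAt
  refine ⟨Metric.ball (S.toMap p) r, fun w ↦ g (L w + c), Metric.isOpen_ball,
    Metric.mem_ball_self hr, contDiffOn_complex_of_real Metric.isOpen_ball hH fun w hw ↦ ?_, ?_⟩
  · refine (differentiableAt_complex_of_fderiv_I ((hH.contDiffAt
      (Metric.isOpen_ball.mem_nhds hw)).differentiableAt (by simp))
        fun v ↦ ?_).differentiableWithinAt
    rw [hsum w hw, hsum w hw, smul_eq_mul, Finset.mul_sum]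
    exact Finset.sum_congr rfl fun j _ ↦ by simp [mul_assoc]
  · have hball : S.coord.source ∩ S.coord ⁻¹' Metric.ball (S.coord p) r ∈ 𝓝 p :=
      (S.coord.isOpen_inter_preimage Metric.isOpen_ball).mem_nhds ⟨hp, Metric.mem_ball_self hr⟩
    filter_upwards [hball] with q ⟨hq, hqr⟩
    rw [Set.mem_preimage] at hqr
    have hw : S.toMap q ∈ Metric.ball (S.toMap p) r := by
      rw [Metric.mem_ball, dist_pi_lt_iff hr] at hqr ⊢
      exact fun j ↦ hqr (Fin.castLE S.le j)
    -- `z` is the point of the slice with the same `w`-coordinates as `q`. The segment joining them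
    -- stays in the ball and its direction has no `w`-component, so `g` has zero derivative along
    -- it.
    set z := L (S.toMap q) + c with hz
    have hzr : z ∈ Metric.ball (S.coord p) r := hLc hw
    have hseg {t : ℝ} (ht : t ∈ Set.Icc (0 : ℝ) 1) :
        AffineMap.lineMap (S.coord q) z t ∈ O :=
      hrO ((convex_ball _ _).lineMap_mem hqr hzr ht)
    have hcst := constant_of_has_deriv_right_zero
      (f := fun t : ℝ ↦ g (AffineMap.lineMap (S.coord q) z t)) (a := 0) (b := 1)
      (fun t ht ↦ (ContinuousAt.comp (g := g) (hgd (hseg ht)).continuousAt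
        AffineMap.lineMap_continuous.continuousAt).continuousWithinAt)
      (fun t ht ↦ by
        have hy := hseg (Set.Ico_subset_Icc_self ht)
        have h1 := ((hgd hy).differentiableAt (by simp)).hasFDerivAt.comp_hasDerivAt t
          AffineMap.hasDerivAt_lineMap
        rw [S.fderiv_comp_symm_eq_sum hV hh hy.1 hy.2, Finset.sum_eq_zero] at h1
        · exact h1.hasDerivWithinAt
        · intro j _
          have : (z - S.coord q) (Fin.castLE S.le j) = 0 := by
            simp [hz, hL, hc, toMap]
          rw [this, zero_mul]) 1 (by simp)
    simp only [AffineMap.lineMap_apply_one, AffineMap.lineMap_apply_zero] at hcst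
    rw [hcst, hg, Function.comp_apply, S.coord.left_inv hq]

end SpencerSystem

end Spencer

/-! ### Restriction of scalars, and pullback by `f_U` -/

namespace Spencer

section RestrictScalars

variable {E F : Type*} [NormedAddCommGroup E] [NormedSpace ℂ E] [NormedAddCommGroup F]
    [NormedSpace ℂ F] {N N' : Type*} [TopologicalSpace N] [ChartedSpace E N]
    [TopologicalSpace N'] [ChartedSpace F N']

/-- The charts do not involve the scalars, so only the smoothness of the expression in charts has to
be restricted. -/
theorem contMDiffAt_real_of_complex {f : N → N'} {x : N} {k : ℕ∞ω}
    (hf : ContMDiffAt 𝓘(ℂ, E) 𝓘(ℂ, F) k f x) : ContMDiffAt 𝓘(ℝ, E) 𝓘(ℝ, F) k f x := by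
  rw [contMDiffAt_iff] at hf ⊢
  exact ⟨hf.1, hf.2.restrict_scalars ℝ⟩

theorem hasMFDerivAt_real_of_complex {f : N → N'} {x : N} {f' : E →L[ℂ] F}
    (hf : HasMFDerivAt 𝓘(ℂ, E) 𝓘(ℂ, F) f x f') :
    HasMFDerivAt 𝓘(ℝ, E) 𝓘(ℝ, F) f x (f'.restrictScalars ℝ) :=
  ⟨hf.1, hf.2.restrictScalars ℝ⟩

end RestrictScalars

variable {n : ℕ} {M : Type u} [TopologicalSpace M]
  [ChartedSpace (EuclideanSpace ℝ (Fin (2 * n))) M] [IsManifold (𝓡 (2 * n)) ∞ M]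
  {J : AlmostComplexStructure n M} {m : ℕ}

/-- The differential at `p` of a map from `M` into a manifold `N` modelled on `F`, as a linear map
with values in `F`. -/
noncomputable def modelDifferential {F : Type*} [NormedAddCommGroup F] [NormedSpace ℂ F]
    {N : Type*} [TopologicalSpace N] [ChartedSpace F N] (f : M → N) (p : M) :
    TangentSpace (𝓡 (2 * n)) p →L[ℝ] F :=
  mfderiv (𝓡 (2 * n)) 𝓘(ℝ, F) f p

namespace SpencerSystem

variable (S : SpencerSystem J m)

theorem contMDiffAt_toMap {p : M} (hp : p ∈ S.dom) :
    ContMDiffAt (𝓡 (2 * n)) 𝓘(ℝ, Fin m → ℂ) ∞ S.toMap p :=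
  contMDiffAt_pi_space.2 fun j ↦ (S.almostHolomorphic j p hp).1

theorem mapDifferential_toMap_apply {p : M} (hp : p ∈ S.dom) (v : TangentSpace (𝓡 (2 * n)) p)
    (j : Fin m) :
    mapDifferential (m := m) S.toMap p v j =
      differential (fun q ↦ S.coord q (Fin.castLE S.le j)) p v := by
  let π : (Fin m → ℂ) →L[ℝ] ℂ := ContinuousLinearMap.proj (R := ℝ) (φ := fun _ : Fin m ↦ ℂ) j
  exact (DFunLike.congr_fun (π.hasMFDerivAt.comp p ((S.contMDiffAt_toMap hp).mdifferentiableAt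
    (by simp)).hasMFDerivAt).mfderiv v).symm

theorem mapDifferential_toMap_J {p : M} (hp : p ∈ S.dom) (v : TangentSpace (𝓡 (2 * n)) p) :
    mapDifferential (m := m) S.toMap p (J.toFun p v) =
      Complex.I • mapDifferential (m := m) S.toMap p v := by
  funext j
  rw [Pi.smul_apply, S.mapDifferential_toMap_apply hp, S.mapDifferential_toMap_apply hp]
  exact (S.almostHolomorphic j p hp).2 v

variable {F : Type*} [NormedAddCommGroup F] [NormedSpace ℂ F] {N : Type*} [TopologicalSpace N]
  [ChartedSpace F N]

/-- The composition of `f_U` with a holomorphic map is smooth. -/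
theorem contMDiffAt_comp_toMap {G : (Fin m → ℂ) → N} {p : M} (hp : p ∈ S.dom)
    (hG : ContMDiffAt 𝓘(ℂ, Fin m → ℂ) 𝓘(ℂ, F) ∞ G (S.toMap p)) :
    ContMDiffAt (𝓡 (2 * n)) 𝓘(ℝ, F) ∞ (G ∘ S.toMap) p :=
  (contMDiffAt_real_of_complex hG).comp p (S.contMDiffAt_toMap hp)

/-- The composition of `f_U` with a holomorphic map satisfies `J^* df = i df`. -/
theorem modelDifferential_comp_toMap_J {G : (Fin m → ℂ) → N} {p : M} (hp : p ∈ S.dom)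
    (hG : ContMDiffAt 𝓘(ℂ, Fin m → ℂ) 𝓘(ℂ, F) ∞ G (S.toMap p))
    (v : TangentSpace (𝓡 (2 * n)) p) :
    modelDifferential (F := F) (G ∘ S.toMap) p (J.toFun p v) =
      Complex.I • modelDifferential (F := F) (G ∘ S.toMap) p v := by
  let G' : (Fin m → ℂ) →L[ℂ] F := mfderiv 𝓘(ℂ, Fin m → ℂ) 𝓘(ℂ, F) G (S.toMap p)
  have h : HasMFDerivAt 𝓘(ℂ, Fin m → ℂ) 𝓘(ℂ, F) G (S.toMap p) G' :=
    (hG.mdifferentiableAt (by simp)).hasMFDerivAt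
  have key (w : TangentSpace (𝓡 (2 * n)) p) :
      modelDifferential (F := F) (G ∘ S.toMap) p w =
        G' (mapDifferential (m := m) S.toMap p w) :=
    DFunLike.congr_fun ((hasMFDerivAt_real_of_complex h).comp p
      ((S.contMDiffAt_toMap hp).mdifferentiableAt (by simp)).hasMFDerivAt).mfderiv w
  rw [key, key, S.mapDifferential_toMap_J hp]
  exact G'.map_smul _ _

theorem almostHolomorphicAt_comp_toMap {H : (Fin m → ℂ) → ℂ} {p : M} (hp : p ∈ S.dom)
    (hH : ContDiffAt ℂ ∞ H (S.toMap p)) : AlmostHolomorphicAt J (H ∘ S.toMap) p :=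
  ⟨S.contMDiffAt_comp_toMap hp hH.contMDiffAt,
    fun v ↦ S.modelDifferential_comp_toMap_J hp hH.contMDiffAt v⟩

/-- In the coordinates, `f_U` is the surjective linear projection `ℂⁿ → ℂ^m`, hence open. -/
theorem isOpen_image_toMap {V : Set M} (hV : IsOpen V) (hVS : V ⊆ S.dom) :
    IsOpen (S.toMap '' V) := by
  have h : IsOpen (S.coord '' V) := S.coord.isOpen_image_of_subset_source hV hVS
  have : IsOpenMap fun x : Fin n → ℂ ↦ fun j : Fin m ↦ x (Fin.castLE S.le j) := by
    let π : (Fin n → ℂ) →L[ℂ] (Fin m → ℂ) := ContinuousLinearMap.pi fun j ↦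
      ContinuousLinearMap.proj (R := ℂ) (φ := fun _ : Fin n ↦ ℂ) (Fin.castLE S.le j)
    refine π.isOpenMap fun w ↦ ?_
    refine ⟨fun k ↦ if hk : k.1 < m then w ⟨k.1, hk⟩ else 0, funext fun j ↦ ?_⟩
    simp [π]
  have h' := this _ h
  rwa [Set.image_image] at h'

end SpencerSystem

/-- Maximality gives the forward direction in every chart; for the converse one chart around each
point suffices. -/
theorem almostHolomorphicOn_iff {ι : Type*} (A : SpencerAtlas J m ι) {V : Set M} (hV : IsOpen V)
    (h : M → ℂ) :
    AlmostHolomorphicOn J h V ↔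
      ∀ p ∈ V, ∀ i, p ∈ (A.chart i).dom →
        ∃ (W : Set (Fin m → ℂ)) (H : (Fin m → ℂ) → ℂ),
          IsOpen W ∧ (A.chart i).toMap p ∈ W ∧ ContDiffOn ℂ ∞ H W ∧
          ∀ᶠ q in 𝓝 p, h q = H ((A.chart i).toMap q) := by
  refine ⟨fun hh p hp i hi ↦ (A.chart i).exists_holomorphic_eventuallyEq hV hh hp hi,
    fun hh p hp ↦ ?_⟩
  obtain ⟨i, hi⟩ := A.covers p
  obtain ⟨W, H, hW, hpW, hH, e⟩ := hh p hp i hi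
  exact ((A.chart i).almostHolomorphicAt_comp_toMap hi
    (hH.contDiffAt (hW.mem_nhds hpW))).congr_of_eventuallyEq e

end Spencer

/-! ### Inverse images of sheaves, tested on stalks -/

namespace Spencer

section Sheaves

variable {X Y : TopCat.{u}} (f : X ⟶ Y)

/-- A morphism of presheaves of rings that is bijective on stalks is locally bijective. -/
theorem W_of_bijective_stalkFunctor_map {P Q : X.Presheaf CommRingCat.{u}} (ψ : P ⟶ Q)
    (h : ∀ x : X, Function.Bijective ((TopCat.Presheaf.stalkFunctor CommRingCat.{u} x).map ψ)) :
    (Opens.grothendieckTopology X).W ψ := by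
  have h1 : CategoryTheory.Presheaf.IsLocallySurjective (Opens.grothendieckTopology X) ψ :=
    (TopCat.Presheaf.locally_surjective_iff_surjective_on_stalks ψ).2 fun x ↦ (h x).2
  have h2 : CategoryTheory.Presheaf.IsLocallyInjective (Opens.grothendieckTopology X) ψ := by
    constructor
    intro U s t hst x hx
    have hg : P.germ U.unop x hx s = P.germ U.unop x hx t := by
      apply (h x).1
      have e1 := TopCat.Presheaf.stalkFunctor_map_germ_apply U.unop x hx ψ s
      have e2 := TopCat.Presheaf.stalkFunctor_map_germ_apply U.unop x hx ψ t
      refine e1.trans (Eq.trans ?_ e2.symm)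
      exact congrArg _ hst
    obtain ⟨W, hxW, i, i', e⟩ := P.germ_eq x hx hx s t hg
    exact ⟨W, i, by simpa [Subsingleton.elim i' i] using e, hxW⟩
  exact (Opens.grothendieckTopology X).W_of_isLocallyBijective ψ

/-- Composition with the adjoint `L A ⟶ B` of a morphism `φ : A ⟶ R B`. -/
theorem homEquiv_homEquiv_symm_comp {C D : Type*} [Category* C] [Category* D] {L : C ⥤ D}
    {R : D ⥤ C} (adj : L ⊣ R) {A : C} {B K : D} (φ : A ⟶ R.obj B) (α : B ⟶ K) :
    adj.homEquiv A K ((adj.homEquiv A B).symm φ ≫ α) = φ ≫ R.map α := by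
  rw [Adjunction.homEquiv_naturality_right, Equiv.apply_symm_apply]

/-- The adjoint of `φ : A ⟶ R B` is bijective on morphisms to `K` if and only if
`α ↦ φ ≫ R α` is. -/
theorem bijective_homEquiv_symm_comp_iff {C D : Type*} [Category* C] [Category* D] {L : C ⥤ D}
    {R : D ⥤ C} (adj : L ⊣ R) {A : C} {B K : D} (φ : A ⟶ R.obj B) :
    Function.Bijective (fun α : B ⟶ K ↦ (adj.homEquiv A B).symm φ ≫ α) ↔
      Function.Bijective (fun α : B ⟶ K ↦ φ ≫ R.map α) := by
  rw [← (adj.homEquiv A K).bijective.of_comp_iff']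
  have : (fun α : B ⟶ K ↦ φ ≫ R.map α) =
      adj.homEquiv A K ∘ fun α : B ⟶ K ↦ (adj.homEquiv A B).symm φ ≫ α :=
    funext fun α ↦ (homEquiv_homEquiv_symm_comp adj φ α).symm
  rw [this]

/-- A morphism `G ⟶ f_* F` of sheaves of rings corresponds to an isomorphism `f⁻¹ G ⟶ F` if the
corresponding morphism from the inverse image presheaf is a local isomorphism. -/
theorem isIso_homEquiv_symm_of_W {F : X.Sheaf CommRingCat.{u}} {G : Y.Sheaf CommRingCat.{u}}
    (φ : G ⟶ (TopCat.Sheaf.pushforward CommRingCat.{u} f).obj F)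
    (h : (Opens.grothendieckTopology X).W
      (((TopCat.Presheaf.pullbackPushforwardAdjunction CommRingCat.{u} f).homEquiv G.1 F.1).symm
        φ.hom)) :
    IsIso (((TopCat.Sheaf.pullbackPushforwardAdjunction CommRingCat.{u} f).homEquiv G F).symm
      φ) := by
  -- Test against every sheaf `K`. Through the sheaf adjunction the condition says that `α ↦ φ ≫ f_*
  -- α` is bijective; through the presheaf adjunction the same condition is what membership in `W`
  -- gives for `K`.
  rw [isIso_iff_coyoneda_map_bijective]
  intro K
  rw [bijective_homEquiv_symm_comp_iff]
  have hK := (bijective_homEquiv_symm_comp_iff _ _).1 (h K.1 K.2)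
  constructor
  · intro α β hαβ
    exact Sheaf.hom_ext (hK.1 (congrArg (fun t ↦ t.hom) hαβ))
  · intro γ
    obtain ⟨α, hα⟩ := hK.2 γ.hom
    exact ⟨⟨α⟩, Sheaf.hom_ext hα⟩

/-- Makes the adjoint of `φ` computable on stalks. The germ of `s`, carried to the inverse image
presheaf, is the germ of the unit applied to `s`, and the unit followed by the adjoint is `φ`. -/
theorem stalkFunctor_map_stalkPullbackHom_germ {P : X.Presheaf CommRingCat.{u}}
    {Q : Y.Presheaf CommRingCat.{u}}
    (φ : Q ⟶ (TopCat.Presheaf.pushforward CommRingCat.{u} f).obj P) (x : X) (U : Opens Y)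
    (hU : f x ∈ U) (s : Q.obj (op U)) :
    (TopCat.Presheaf.stalkFunctor CommRingCat.{u} x).map
        (((TopCat.Presheaf.pullbackPushforwardAdjunction CommRingCat.{u} f).homEquiv Q P).symm φ)
        (TopCat.Presheaf.stalkPullbackHom CommRingCat.{u} f Q x (Q.germ U (f x) hU s)) =
      P.germ ((Opens.map f).obj U) x hU (φ.app (op U) s) := by
  let adj := TopCat.Presheaf.pullbackPushforwardAdjunction CommRingCat.{u} f
  let ψ := (adj.homEquiv Q P).symm φ
  have hψ : adj.unit.app Q ≫ (TopCat.Presheaf.pushforward CommRingCat.{u} f).map ψ = φ :=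
    (adj.homEquiv_unit _ _ _).symm.trans (Equiv.apply_symm_apply _ _)
  have e1 := congrArg (fun t ↦ t.hom s)
    (TopCat.Presheaf.germ_stalkPullbackHom CommRingCat.{u} f Q x U hU)
  have e2 := TopCat.Presheaf.stalkFunctor_map_germ_apply ((Opens.map f).obj U) x hU ψ
    ((adj.unit.app Q).app (op U) s)
  have e3 := congrArg (fun t ↦ (t.app (op U)).hom s) hψ
  exact (congrArg ((TopCat.Presheaf.stalkFunctor CommRingCat.{u} x).map ψ).hom e1).trans
    (e2.trans (congrArg (P.germ ((Opens.map f).obj U) x hU).hom e3))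

/-- The morphism `f⁻¹ Q ⟶ P` of presheaves corresponding to `φ : Q ⟶ f_* P` is bijective on stalks
if every germ of `P` comes from exactly one germ of `Q`. -/
theorem bijective_stalkFunctor_map_homEquiv_symm {P : X.Presheaf CommRingCat.{u}}
    {Q : Y.Presheaf CommRingCat.{u}}
    (φ : Q ⟶ (TopCat.Presheaf.pushforward CommRingCat.{u} f).obj P) (x : X)
    (hinj : ∀ (U V : Opens Y) (hU : f x ∈ U) (hV : f x ∈ V) (s : Q.obj (op U)) (t : Q.obj (op V)),
      P.germ ((Opens.map f).obj U) x hU (φ.app (op U) s) =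
        P.germ ((Opens.map f).obj V) x hV (φ.app (op V) t) →
      Q.germ U (f x) hU s = Q.germ V (f x) hV t)
    (hsurj : ∀ a : P.stalk x, ∃ (U : Opens Y) (hU : f x ∈ U) (s : Q.obj (op U)),
      P.germ ((Opens.map f).obj U) x hU (φ.app (op U) s) = a) :
    Function.Bijective ((TopCat.Presheaf.stalkFunctor CommRingCat.{u} x).map
      (((TopCat.Presheaf.pullbackPushforwardAdjunction CommRingCat.{u} f).homEquiv Q P).symm
        φ)) := by
  have hex (a : ((TopCat.Presheaf.pullback CommRingCat.{u} f).obj Q).stalk x) :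
      ∃ (U : Opens Y) (hU : f x ∈ U) (s : Q.obj (op U)),
        TopCat.Presheaf.stalkPullbackHom CommRingCat.{u} f Q x (Q.germ U (f x) hU s) = a := by
    obtain ⟨b, rfl⟩ := (ConcreteCategory.bijective_of_isIso
      (TopCat.Presheaf.stalkPullbackIso CommRingCat.{u} f Q x).hom).2 a
    obtain ⟨U, hU, s, rfl⟩ := Q.exists_germ_eq b
    exact ⟨U, hU, s, rfl⟩
  constructor
  · intro a b hab
    obtain ⟨U, hU, s, rfl⟩ := hex a
    obtain ⟨V, hV, t, rfl⟩ := hex b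
    exact congrArg (TopCat.Presheaf.stalkPullbackHom CommRingCat.{u} f Q x).hom
      (hinj U V hU hV s t ((stalkFunctor_map_stalkPullbackHom_germ f φ x U hU s).symm.trans
        (hab.trans (stalkFunctor_map_stalkPullbackHom_germ f φ x V hV t))))
  · intro a
    obtain ⟨U, hU, s, rfl⟩ := hsurj a
    exact ⟨_, stalkFunctor_map_stalkPullbackHom_germ f φ x U hU s⟩

end Sheaves

variable {X Y : Type u} [TopologicalSpace X] [TopologicalSpace Y]

/-- A sheaf `F` of functions on `X` is the inverse image of a sheaf `G` of functions on `Y` under an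
open map `f`, if composition with `f` maps sections of `G` to sections of `F` and all sections of
`F` are obtained locally in this way. -/
theorem isInverseImage_of_isOpenMap (f : C(X, Y)) (hf : IsOpenMap f) (F : FunctionCondition X)
    (G : FunctionCondition Y)
    (hcomp : ∀ (W : Opens (TopCat.of Y)), ∀ g ∈ G.sections W,
      (fun x : (Opens.map (TopCat.ofHom f)).obj W ↦ g ⟨f x.1, x.2⟩) ∈
        F.sections ((Opens.map (TopCat.ofHom f)).obj W))
    (hsurj : ∀ (U : Opens (TopCat.of X)), ∀ s ∈ F.sections U, ∀ x : U,
      ∃ (W : Opens (TopCat.of Y)) (_ : f x.1 ∈ W), ∃ g ∈ G.sections W,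
        ∀ᶠ y in 𝓝 x.1, ∀ (hy : y ∈ U) (hy' : f y ∈ W), s ⟨y, hy⟩ = g ⟨f y, hy'⟩) :
    IsInverseImage f F G := by
  let φ₀ : G.presheaf ⟶ (TopCat.Presheaf.pushforward CommRingCat.{u} (TopCat.ofHom f)).obj
      F.presheaf :=
    { app W := CommRingCat.ofHom
        { toFun g := ⟨_, hcomp W.unop g.1 g.2⟩
          map_one' := rfl
          map_mul' _ _ := rfl
          map_zero' := rfl
          map_add' _ _ := rfl }
      naturality _ _ _ := rfl }
  let φ : G.sheaf ⟶ (TopCat.Sheaf.pushforward CommRingCat.{u} (TopCat.ofHom f)).obj F.sheaf :=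
    ⟨φ₀⟩
  refine ⟨φ, fun W g x ↦ rfl, isIso_homEquiv_symm_of_W _ φ
    (W_of_bijective_stalkFunctor_map _ fun x ↦
      bijective_stalkFunctor_map_homEquiv_symm _ φ₀ x ?_ ?_)⟩
  · intro W₁ W₂ hx₁ hx₂ g₁ g₂ hab
    obtain ⟨V, hxV, i₁, i₂, e⟩ := F.presheaf.germ_eq x _ _ _ _ hab
    -- Openness of `f` gives injectivity on stalks: if `g₁ ∘ f = g₂ ∘ f` on `V`, then `g₁ = g₂` on
    -- `f(V)`, which is a neighbourhood of `f x`.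
    let W : Opens (TopCat.of Y) := ⟨f '' (V : Set X), hf _ V.isOpen⟩
    have j₁ : W ≤ W₁ := by
      rintro _ ⟨y, hy, rfl⟩
      exact i₁.le hy
    have j₂ : W ≤ W₂ := by
      rintro _ ⟨y, hy, rfl⟩
      exact i₂.le hy
    refine TopCat.Presheaf.germ_ext G.presheaf W ⟨x, hxV, rfl⟩ (homOfLE j₁) (homOfLE j₂) ?_
    refine Subtype.ext (funext ?_)
    rintro ⟨_, y, hy, rfl⟩
    exact congrFun (congrArg Subtype.val e) ⟨y, hy⟩
  · intro a
    obtain ⟨U, hxU, s, rfl⟩ := F.presheaf.exists_germ_eq a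
    obtain ⟨W, hxW, g, hg, e⟩ := hsurj U s.1 s.2 ⟨x, hxU⟩
    refine ⟨W, hxW, ⟨g, hg⟩, ?_⟩
    obtain ⟨V, hV, hVo, hxV⟩ := mem_nhds_iff.1 e
    let V' : Opens (TopCat.of X) :=
      ⟨V, hVo⟩ ⊓ U ⊓ (Opens.map (TopCat.ofHom f)).obj W
    refine TopCat.Presheaf.germ_ext F.presheaf V' ⟨⟨hxV, hxU⟩, hxW⟩
      (homOfLE inf_le_right) (homOfLE (inf_le_left.trans inf_le_right)) ?_
    refine Subtype.ext (funext fun y ↦ ?_)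
    exact (hV y.2.1.1 y.2.1.2 y.2.2).symm

end Spencer

/-! ### Transition mappings and the glued mapping -/

namespace Spencer

variable {n : ℕ} {M : Type u} [TopologicalSpace M]
  [ChartedSpace (EuclideanSpace ℝ (Fin (2 * n))) M] [IsManifold (𝓡 (2 * n)) ∞ M]
  {J : AlmostComplexStructure n M} {m : ℕ}

namespace SpencerSystem

variable (S T : SpencerSystem J m)

/-- The holomorphic coordinates of one system are locally holomorphic functions of those of any
other one. -/
theorem exists_holomorphic_toMap_eventuallyEq {p : M} (hS : p ∈ S.dom) (hT : p ∈ T.dom) :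
    ∃ (W : Set (Fin m → ℂ)) (G : (Fin m → ℂ) → (Fin m → ℂ)), IsOpen W ∧ S.toMap p ∈ W ∧
      ContDiffOn ℂ ∞ G W ∧ ∀ᶠ q in 𝓝 p, T.toMap q = G (S.toMap q) := by
  choose W G hW hp hG e using fun j ↦
    S.exists_holomorphic_eventuallyEq T.isOpen_dom (T.almostHolomorphic j) hT hS
  refine ⟨⋂ j, W j, fun w j ↦ G j w, isOpen_iInter_of_finite hW, Set.mem_iInter.2 hp,
    contDiffOn_pi.2 fun j ↦ (hG j).mono (Set.iInter_subset _ _), ?_⟩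
  filter_upwards [Filter.eventually_all.2 e] with q hq
  exact funext hq

/-- Each of `f_S`, `f_T` is near `p` a holomorphic function of the other. On the images of a small
`V` these two functions are mutually inverse, and the images are open. -/
theorem exists_isTransition {p : M} (hS : p ∈ S.dom) (hT : p ∈ T.dom) :
    ∃ H, IsTransition S T H ∧ S.toMap p ∈ H.source ∧ H (S.toMap p) = T.toMap p := by
  obtain ⟨W, G, hW, hpW, hG, e⟩ := S.exists_holomorphic_toMap_eventuallyEq T hS hT
  obtain ⟨W', G', hW', hpW', hG', e'⟩ := T.exists_holomorphic_toMap_eventuallyEq S hT hS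
  have eW : ∀ᶠ q in 𝓝 p, S.toMap q ∈ W :=
    (S.contMDiffAt_toMap hS).continuousAt.eventually (hW.mem_nhds hpW)
  have eW' : ∀ᶠ q in 𝓝 p, T.toMap q ∈ W' :=
    (T.contMDiffAt_toMap hT).continuousAt.eventually (hW'.mem_nhds hpW')
  have ed : ∀ᶠ q in 𝓝 p, q ∈ S.dom ∩ T.dom :=
    (S.isOpen_dom.inter T.isOpen_dom).mem_nhds ⟨hS, hT⟩
  obtain ⟨V, hV, hVo, hpV⟩ := eventually_nhds_iff.1 (e.and (e'.and (eW.and (eW'.and ed))))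
  have hGW : ContDiffOn ℂ ∞ G (S.toMap '' V) := hG.mono (by
    rintro _ ⟨q, hq, rfl⟩
    exact (hV q hq).2.2.1)
  have hGW' : ContDiffOn ℂ ∞ G' (T.toMap '' V) := hG'.mono (by
    rintro _ ⟨q, hq, rfl⟩
    exact (hV q hq).2.2.2.1)
  let H : OpenPartialHomeomorph (Fin m → ℂ) (Fin m → ℂ) :=
    { toFun := G
      invFun := G'
      source := S.toMap '' V
      target := T.toMap '' V
      map_source' := by
        rintro _ ⟨q, hq, rfl⟩
        exact ⟨q, hq, (hV q hq).1⟩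
      map_target' := by
        rintro _ ⟨q, hq, rfl⟩
        exact ⟨q, hq, (hV q hq).2.1⟩
      left_inv' := by
        rintro _ ⟨q, hq, rfl⟩
        rw [← (hV q hq).1, ← (hV q hq).2.1]
      right_inv' := by
        rintro _ ⟨q, hq, rfl⟩
        rw [← (hV q hq).2.1, ← (hV q hq).1]
      open_source := S.isOpen_image_toMap hVo fun q hq ↦ (hV q hq).2.2.2.2.1
      open_target := T.isOpen_image_toMap hVo fun q hq ↦ (hV q hq).2.2.2.2.2
      continuousOn_toFun := hGW.continuousOn
      continuousOn_invFun := hGW'.continuousOn }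
  exact ⟨H, ⟨V, hVo, fun q hq ↦ (hV q hq).2.2.2.2, rfl, rfl, hGW, hGW', fun q hq ↦ (hV q hq).1⟩,
    ⟨p, hpV, rfl⟩, (hV p hpV).1.symm⟩

end SpencerSystem

namespace SpencerAtlas

variable {ι : Type*} (A : SpencerAtlas J m ι)

theorem continuous_proj : Continuous A.proj :=
  continuous_uliftUp.comp continuous_quotient_mk'

/-- A single transition mapping already relates the two values; this makes the glued mapping well
defined. -/
theorem proj_toMap_eq {i j : ι} {p : M} (hi : p ∈ (A.chart i).dom) (hj : p ∈ (A.chart j).dom) :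
    A.proj ((A.chart i).toMap p) = A.proj ((A.chart j).toMap p) := by
  obtain ⟨H, hH, hs, e⟩ := (A.chart i).exists_isTransition (A.chart j) hi hj
  exact congrArg ULift.up (Quotient.sound (Relation.EqvGen.rel _ _ ⟨i, j, H, hH, hs, e⟩))

theorem exists_isGlued : ∃ f : M → A.QuotientSpace, A.IsGlued f := by
  choose i hi using A.covers
  exact ⟨fun p ↦ A.proj ((A.chart (i p)).toMap p), fun j p hj ↦ A.proj_toMap_eq (hi p) hj⟩

variable {A}

theorem IsGlued.eq {f f' : M → A.QuotientSpace} (hf : A.IsGlued f) (hf' : A.IsGlued f') :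
    f' = f := by
  funext p
  obtain ⟨i, hi⟩ := A.covers p
  rw [hf i p hi, hf' i p hi]

theorem IsGlued.eventuallyEq {f : M → A.QuotientSpace} (hf : A.IsGlued f) {i : ι} {p : M}
    (hi : p ∈ (A.chart i).dom) : f =ᶠ[𝓝 p] A.proj ∘ (A.chart i).toMap :=
  Filter.eventually_of_mem ((A.chart i).isOpen_dom.mem_nhds hi) fun q hq ↦ hf i q hq

theorem IsGlued.continuous {f : M → A.QuotientSpace} (hf : A.IsGlued f) : Continuous f := by
  rw [continuous_iff_continuousAt]
  intro p
  obtain ⟨i, hi⟩ := A.covers p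
  exact (A.continuous_proj.continuousAt.comp
    ((A.chart i).contMDiffAt_toMap hi).continuousAt).congr (hf.eventuallyEq hi).symm

variable [ChartedSpace (Fin m → ℂ) A.QuotientSpace]

theorem IsStandardStructure.isLocalDiffeomorphAt (hA : A.IsStandardStructure) {i : ι} {p : M}
    (hi : p ∈ (A.chart i).dom) :
    IsLocalDiffeomorphAt 𝓘(ℂ, Fin m → ℂ) 𝓘(ℂ, Fin m → ℂ) ∞ A.proj ((A.chart i).toMap p) :=
  hA i ⟨_, p, hi, rfl⟩

/-- Locally `f` is the open map `f_U` followed by `A.proj`, a local homeomorphism on `f_U(U)`. -/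
theorem IsGlued.isOpenMap {f : M → A.QuotientSpace} (hf : A.IsGlued f)
    (hA : A.IsStandardStructure) : IsOpenMap f := by
  rw [isOpenMap_iff_nhds_le]
  intro p
  obtain ⟨i, hi⟩ := A.covers p
  rw [Filter.map_congr (hf.eventuallyEq hi), (hf.eventuallyEq hi).eq_of_nhds, ← Filter.map_map]
  have h1 := (hA i).isLocalHomeomorphOn.map_nhds_eq (x := (A.chart i).toMap p) ⟨p, hi, rfl⟩
  rw [Function.comp_apply, ← h1]
  refine Filter.map_mono fun s hs ↦ ?_
  obtain ⟨V, hV, hVo, hpV⟩ := mem_nhds_iff.1 (Filter.mem_map.1 hs)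
  refine Filter.mem_of_superset (((A.chart i).isOpen_image_toMap
    (hVo.inter (A.chart i).isOpen_dom) Set.inter_subset_right).mem_nhds ⟨p, ⟨hpV, hi⟩, rfl⟩) ?_
  rintro _ ⟨q, hq, rfl⟩
  exact hV hq.1

theorem IsGlued.almostHolomorphicMap {f : M → A.QuotientSpace} (hf : A.IsGlued f)
    (hA : A.IsStandardStructure) : AlmostHolomorphicMap J m f := by
  constructor
  · intro p
    obtain ⟨i, hi⟩ := A.covers p
    exact ((A.chart i).contMDiffAt_comp_toMap hi
      (hA.isLocalDiffeomorphAt hi).contMDiffAt).congr_of_eventuallyEq (hf.eventuallyEq hi)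
  · intro p v
    obtain ⟨i, hi⟩ := A.covers p
    have e : mapDifferential (n := n) (m := m) f p =
        modelDifferential (F := Fin m → ℂ) (A.proj ∘ (A.chart i).toMap) p :=
      (hf.eventuallyEq hi).mfderiv_eq
    rw [e]
    exact (A.chart i).modelDifferential_comp_toMap_J hi
      (hA.isLocalDiffeomorphAt hi).contMDiffAt v

/-- The composition of the glued mapping with a holomorphic function is almost holomorphic. -/
theorem IsGlued.almostHolomorphicAt_comp {f : M → A.QuotientSpace} (hf : A.IsGlued f)
    (hA : A.IsStandardStructure) {k : A.QuotientSpace → ℂ} {p : M}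
    (hk : ContMDiffAt 𝓘(ℂ, Fin m → ℂ) 𝓘(ℂ, ℂ) ∞ k (f p)) : AlmostHolomorphicAt J (k ∘ f) p := by
  obtain ⟨i, hi⟩ := A.covers p
  rw [hf i p hi] at hk
  have h : ContDiffAt ℂ ∞ (k ∘ A.proj) ((A.chart i).toMap p) :=
    contMDiffAt_iff_contDiffAt.1 (hk.comp _ (hA.isLocalDiffeomorphAt hi).contMDiffAt)
  exact ((A.chart i).almostHolomorphicAt_comp_toMap hi h).congr_of_eventuallyEq
    ((hf.eventuallyEq hi).fun_comp k)

/-- Near a point, an almost holomorphic function is the composition of the glued mapping with a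
holomorphic function. -/
theorem IsGlued.exists_holomorphic_eventuallyEq {f : M → A.QuotientSpace} (hf : A.IsGlued f)
    (hA : A.IsStandardStructure) {V : Set M} (hV : IsOpen V) {h : M → ℂ}
    (hh : AlmostHolomorphicOn J h V) {p : M} (hp : p ∈ V) :
    ∃ (W : Set A.QuotientSpace) (k : A.QuotientSpace → ℂ), IsOpen W ∧ f p ∈ W ∧
      (∀ y ∈ W, ContMDiffAt 𝓘(ℂ, Fin m → ℂ) 𝓘(ℂ, ℂ) ∞ k y) ∧ ∀ᶠ q in 𝓝 p, h q = k (f q) := by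
  obtain ⟨i, hi⟩ := A.covers p
  obtain ⟨W, H, hW, hpW, hH, e⟩ := (A.chart i).exists_holomorphic_eventuallyEq hV hh hp hi
  have hd := hA.isLocalDiffeomorphAt hi
  -- A holomorphic local section of the projection through `f_U(p)`: it carries the holomorphic
  -- function `H` of the `w^j` to a function near `f(p)`.
  let Λ := hd.localInverse
  have hΛ : ContMDiffOn 𝓘(ℂ, Fin m → ℂ) 𝓘(ℂ, Fin m → ℂ) ∞ Λ Λ.source :=
    hd.localInverse_contMDiffOn
  have hpΛ : Λ (A.proj ((A.chart i).toMap p)) = (A.chart i).toMap p :=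
    hd.localInverse_left_inv hd.localInverse_mem_target
  refine ⟨Λ.source ∩ Λ ⁻¹' W, H ∘ Λ,
    hΛ.continuousOn.isOpen_inter_preimage Λ.open_source hW, ?_, fun y hy ↦ ?_, ?_⟩
  · rw [hf i p hi]
    exact ⟨hd.localInverse_mem_source, by rwa [Set.mem_preimage, hpΛ]⟩
  · exact (hH.contDiffAt (hW.mem_nhds hy.2)).contMDiffAt.comp y
      (hΛ.contMDiffAt (Λ.open_source.mem_nhds hy.1))
  · filter_upwards [e, hf.eventuallyEq hi,
      ((A.chart i).contMDiffAt_toMap hi).continuousAt.eventually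
        hd.localInverse_eventuallyEq_left] with q h1 h2 h3
    rw [h1, h2]
    exact congrArg H h3.symm

/-- The open-map criterion applies: composition with `f` preserves sections, and every almost
holomorphic function descends locally. -/
theorem IsGlued.isInverseImage {f : C(M, A.QuotientSpace)} (hf : A.IsGlued f)
    (hA : A.IsStandardStructure) :
    IsInverseImage f (almostHolomorphic J) (holomorphic m A.QuotientSpace) := by
  refine isInverseImage_of_isOpenMap f (hf.isOpenMap hA) _ _ (fun W g hg x ↦ ?_)
    fun U s hs x ↦ ?_
  · obtain ⟨k, hk, e⟩ := hg ⟨f x.1, x.2⟩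
    refine ⟨k ∘ f, hf.almostHolomorphicAt_comp hA hk, ?_⟩
    have hc : Continuous fun y : (Opens.map (TopCat.ofHom f)).obj W ↦ (⟨f y.1, y.2⟩ : W) :=
      Continuous.subtype_mk (f.continuous.comp continuous_subtype_val) _
    exact hc.continuousAt.eventually e
  · classical
    -- Extension by zero only provides a function on all of `M`; it is used on the open set `U`
    -- alone.
    let h : M → ℂ := fun y ↦ if hy : y ∈ U then s ⟨y, hy⟩ else 0
    have hh : AlmostHolomorphicOn J h U := by
      intro y hy
      obtain ⟨k, hk, e⟩ := hs ⟨y, hy⟩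
      refine AlmostHolomorphicAt.congr_of_eventuallyEq hk ?_
      rw [nhds_subtype_eq_comap, Filter.eventually_comap] at e
      filter_upwards [e, U.isOpen.mem_nhds hy] with z h1 hz
      have h2 : h z = s ⟨z, hz⟩ := dif_pos hz
      rw [h2]
      exact h1 ⟨z, hz⟩ rfl
    obtain ⟨W, k, hW, hxW, hk, e⟩ := hf.exists_holomorphic_eventuallyEq hA U.isOpen hh x.2
    refine ⟨⟨W, hW⟩, hxW, fun y ↦ k y.1,
      fun y ↦ ⟨k, hk y.1 y.2, Filter.Eventually.of_forall fun _ ↦ rfl⟩, ?_⟩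
    filter_upwards [e] with z hz hzU hzW
    rw [← hz]
    have h1 : h z = s ⟨z, hzU⟩ := dif_pos hzU
    exact h1.symm

end SpencerAtlas

end Spencer

/-! ### The theorem -/

theorem lemma4 {n m : ℕ} {M : Type u} [TopologicalSpace M]
    [ChartedSpace (EuclideanSpace ℝ (Fin (2 * n))) M] [IsManifold (𝓡 (2 * n)) ∞ M]
    (J : Spencer.AlmostComplexStructure n M) {ι : Type*} (A : Spencer.SpencerAtlas J m ι) :
    ∃ f : C(M, A.QuotientSpace),
      -- `f` is the glued mapping, and it is the only one
      (A.IsGlued f ∧ ∀ f' : M → A.QuotientSpace, A.IsGlued f' → f' = f) ∧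
      -- in the coordinates `w` the almost holomorphic functions on `M` are locally the
      -- compositions of `f_U` with holomorphic functions
      (∀ (V : Set M), IsOpen V → ∀ h : M → ℂ, Spencer.AlmostHolomorphicOn J h V ↔
        ∀ p ∈ V, ∀ i, p ∈ (A.chart i).dom →
          ∃ (W : Set (Fin m → ℂ)) (H : (Fin m → ℂ) → ℂ),
            IsOpen W ∧ (A.chart i).toMap p ∈ W ∧ ContDiffOn ℂ ∞ H W ∧
            ∀ᶠ q in 𝓝 p, h q = H ((A.chart i).toMap q)) ∧
      -- when `ℂ^m/Γ` is equipped with the standard complex structure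
      (∀ [ChartedSpace (Fin m → ℂ) A.QuotientSpace]
          [IsManifold 𝓘(ℂ, Fin m → ℂ) ∞ A.QuotientSpace], A.IsStandardStructure →
        Spencer.AlmostHolomorphicMap J m f ∧
        Spencer.IsInverseImage f (Spencer.almostHolomorphic J)
          (Spencer.holomorphic m A.QuotientSpace)) := by
  obtain ⟨f, hf⟩ := A.exists_isGlued
  have hf' : A.IsGlued (⟨f, hf.continuous⟩ : C(M, A.QuotientSpace)) := hf
  exact ⟨⟨f, hf.continuous⟩, ⟨hf', fun _ h ↦ hf'.eq h⟩,
    fun V hV h ↦ Spencer.almostHolomorphicOn_iff A hV h,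
    fun hA ↦ ⟨hf'.almostHolomorphicMap hA, hf'.isInverseImage hA⟩⟩
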